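/- Let $G$ be a finite group. A Carter subgroup of $G$ is a nilpotent subgroup $C \le G$ with $N_G(C) = C$. We say that $G$ has a Sylow tower if there is a series $1 = H_0 \le H_1 \le \dots \le H_n = G$ of normal subgroups of $G$ such that each factor $H_{i+1}/H_i$ is isomorphic to a Sylow subgroup of $G$; and $G$ is supersoluble if there is such a series of normal subgroups of $G$ in which each factor $H_{i+1}/H_i$ is cyclic. If $G$ has a Sylow tower, then for every Carter subgroup $C$ of $G$ and every subgroup $X \le C$, the number of Carter subgroups of $G$ that contain $X$ divides the index $(G:C)$. In particular, the same conclusion holds for every finite supersoluble group $G$. -/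

import Mathlib

/-- A Carter subgroup: a nilpotent self-normalising subgroup. -/
def IsCarterSubgroup {G : Type*} [Group G] (C : Subgroup G) : Prop :=
  Group.IsNilpotent C ∧ Subgroup.normalizer (C : Set G) = C

/-- The number of Carter subgroups of `G` that contain `X`. -/
noncomputable def carterCount {G : Type*} [Group G] (X : Subgroup G) : ℕ :=
  Nat.card {D : Subgroup G // IsCarterSubgroup D ∧ X ≤ D}

/-- A finite ascending series `1 = H 0 ≤ H 1 ≤ ⋯ ≤ H length = G` of normal subgroups of `G`.
The terms beyond `length` are all equal to `G`, since `H` is monotone. -/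
structure NormalSeries (G : Type*) [Group G] where
  length : ℕ
  term : ℕ → Subgroup G
  mono : Monotone term
  term_zero : term 0 = ⊥
  term_length : term length = ⊤
  normal : ∀ i, (term i).Normal

attribute [instance] NormalSeries.normal

/-- The factor group `H (i + 1) / H i` of a normal series. -/
abbrev NormalSeries.Factor {G : Type*} [Group G] (S : NormalSeries G) (i : ℕ) : Type _ :=
  S.term (i + 1) ⧸ (S.term i).subgroupOf (S.term (i + 1))

/-- `G` has a Sylow tower: a normal series each of whose factors is isomorphic to a Sylow
subgroup of `G`. -/
def HasSylowTower (G : Type*) [Group G] : Prop :=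
  ∃ S : NormalSeries G, ∀ i < S.length,
    ∃ p : ℕ, p.Prime ∧ ∃ P : Sylow p G, Nonempty (S.Factor i ≃* P)

/-- `G` is supersoluble: it has a normal series with cyclic factors. -/
def IsSupersoluble (G : Type*) [Group G] : Prop :=
  ∃ S : NormalSeries G, ∀ i < S.length, IsCyclic (S.Factor i)

/-! The proof is by induction on the order, over groups in which every nontrivial subgroup has a
nontrivial normal Sylow subgroup. Let `P = ker f` be a normal Sylow `p`-subgroup and `L` the
quotient. By Schur–Zassenhaus, the Carter subgroups of the group are exactly the `Q C_P(Q)` with `Q`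
a `p'`-subgroup whose image in `L` is Carter, and `Q` is determined by `Q C_P(Q)`. In particular
conjugacy of Carter subgroups lifts from `L`.

Let `Y` be a complement of `X ∩ P` in `X`, and `Z = C(X ∩ P)`. Then `X ≤ Q C_P(Q)` if and only if `Y
≤ Q ≤ Z`. Sorted by image, these `Q` number `a * b`. Here `a` counts the Carter subgroups of `L`
between `f(Y)` and `W = f(Z)`, and `b`, the size of each fibre, is `|B : C_B(Q)|` with `B = C_{P ∩
Z}(Y)`. Conjugacy in `W` makes `a` a Carter count of `W`, so by induction it divides `|W : f(Q)|`,
hence `|L : f(Q)|`. As a power of `p` not exceeding `|P : C_P(Q)|`, `b` divides that index. The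
product of the two indices is `|G : Q C_P(Q)|`. -/

open scoped Pointwise

namespace Subgroup

/-! ### Conjugates of subgroups -/

section Conjugation

variable {G L : Type*} [Group G] [Group L]

theorem mem_conj_smul_iff {g x : G} {Q : Subgroup G} :
    x ∈ MulAut.conj g • Q ↔ g⁻¹ * x * g ∈ Q := by
  rw [mem_pointwise_smul_iff_inv_smul_mem, ← map_inv, MulAut.smul_def, MulAut.conj_apply, inv_inv]

theorem conj_mem_conj_smul {g x : G} {Q : Subgroup G} (hx : x ∈ Q) :
    g * x * g⁻¹ ∈ MulAut.conj g • Q := by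
  rw [mem_conj_smul_iff]
  simpa [mul_assoc] using hx

theorem map_conj_smul (f : G →* L) (g : G) (Q : Subgroup G) :
    (MulAut.conj g • Q).map f = MulAut.conj (f g) • Q.map f := by
  ext x
  simp only [mem_map, mem_conj_smul_iff]
  constructor
  · rintro ⟨y, hy, rfl⟩
    exact ⟨_, hy, by simp⟩
  · rintro ⟨y, hy, h⟩
    refine ⟨g * y * g⁻¹, by simpa [mul_assoc] using hy, ?_⟩
    simp [h, mul_assoc]

theorem card_conj_smul (g : G) (Q : Subgroup G) :
    Nat.card ↥(MulAut.conj g • Q) = Nat.card Q :=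
  (Nat.card_congr (equivSMul (MulAut.conj g) Q).toEquiv).symm

theorem mem_normalizer_iff_conj_smul_eq {g : G} {Q : Subgroup G} :
    g ∈ normalizer (Q : Set G) ↔ MulAut.conj g • Q = Q := by
  rw [← inv_mem_iff, mem_normalizer_iff, SetLike.ext_iff]
  refine forall_congr' fun x => ?_
  rw [mem_conj_smul_iff, inv_inv]
  exact iff_comm

end Conjugation

/-! ### Conjugacy in the Schur–Zassenhaus theorem -/

section SchurZassenhausConjugacy

open MulOpposite MulAction

variable {G : Type*} [Group G]

/-- A complement of a commutative normal subgroup of coprime index is the stabilizer of the class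
of transversals that it represents. -/
theorem IsComplement'.exists_stabilizer_quotientDiff_eq [Finite G] {N Q : Subgroup G} [N.Normal]
    [IsMulCommutative N] (hc : (Nat.card N).Coprime N.index) (h : IsComplement' N Q) :
    ∃ α : N.QuotientDiff, stabilizer G α = Q := by
  refine ⟨Quotient.mk'' ⟨(Q : Set G), h.symm⟩, (eq_of_le_of_card_ge (fun q hq => ?_) ?_).symm⟩
  · refine mem_stabilizer_iff.2 (congr_arg Quotient.mk'' (Subtype.ext ?_))
    change op q⁻¹ • (Q : Set G) = Q
    exact op_smul_coe_set (inv_mem hq)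
  · have h1 := (isComplement'_stabilizer_of_coprime
      (α := (Quotient.mk'' ⟨(Q : Set G), h.symm⟩ : N.QuotientDiff)) hc).card_mul_card
    rw [← h.card_mul_card] at h1
    exact (Nat.eq_of_mul_eq_mul_left Nat.card_pos h1).le

theorem IsComplement'.exists_conj_smul_eq_of_isMulCommutative [Finite G] {N Q R : Subgroup G}
    [N.Normal] [IsMulCommutative N] (hc : (Nat.card N).Coprime N.index)
    (hQ : IsComplement' N Q) (hR : IsComplement' N R) :
    ∃ u ∈ N, MulAut.conj u • Q = R := by
  obtain ⟨α, rfl⟩ := hQ.exists_stabilizer_quotientDiff_eq hc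
  obtain ⟨β, rfl⟩ := hR.exists_stabilizer_quotientDiff_eq hc
  obtain ⟨u, rfl⟩ := exists_smul_eq hc α β
  refine ⟨u, u.2, ?_⟩
  exact (stabilizer_smul_eq_stabilizer_map_conj (u : G) α).symm

theorem isComplement'_subgroupOf_of_le_sup [Finite G] {N Q K : Subgroup G} [N.Normal]
    (hN : N ≤ K) (hQ : Q ≤ K) (hK : K ≤ N ⊔ Q) (hc : (Nat.card N).Coprime (Nat.card Q)) :
    IsComplement' (N.subgroupOf K) (Q.subgroupOf K) := by
  refine isComplement'_of_disjoint_and_mul_eq_univ ?_ ?_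
  · refine disjoint_iff.2 ((comap_inf N Q K.subtype).symm.trans ?_)
    rw [(disjoint_of_coprime_natCard hc).eq_bot]
    exact bot_subgroupOf K
  · refine Set.eq_univ_of_forall fun k => ?_
    obtain ⟨n, hn, q, hq, h⟩ := mem_sup_of_normal_left.1 (hK k.2)
    exact ⟨⟨n, hN hn⟩, hn, ⟨q, hQ hq⟩, hq, Subtype.ext h⟩

/-- Equal images give `NQ = NR`, and inside this group `Q` and `R` are both complements of `N`. -/
theorem exists_conj_smul_eq_of_map_mk_eq [Finite G] {N Q R : Subgroup G} [N.Normal]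
    [IsMulCommutative N] (hQ : (Nat.card N).Coprime (Nat.card Q))
    (hR : (Nat.card N).Coprime (Nat.card R))
    (h : Q.map (QuotientGroup.mk' N) = R.map (QuotientGroup.mk' N)) :
    ∃ u ∈ N, MulAut.conj u • Q = R := by
  have h' : N ⊔ Q = N ⊔ R := by
    rw [← QuotientGroup.comap_map_mk', ← QuotientGroup.comap_map_mk', h]
  set K := N ⊔ Q
  have hQK : Q ≤ K := le_sup_right
  have hRK : R ≤ K := h' ▸ le_sup_right
  have hNK : N ≤ K := le_sup_left
  have cQ := isComplement'_subgroupOf_of_le_sup hNK hQK le_rfl hQ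
  have cR := isComplement'_subgroupOf_of_le_sup hNK hRK h'.le hR
  have hc : (Nat.card (N.subgroupOf K)).Coprime (N.subgroupOf K).index := by
    rw [cQ.symm.index_eq_card, Nat.card_congr (subgroupOfEquivOfLe hNK).toEquiv,
      Nat.card_congr (subgroupOfEquivOfLe hQK).toEquiv]
    exact hQ
  obtain ⟨u, hu, e⟩ := cQ.exists_conj_smul_eq_of_isMulCommutative hc cR
  refine ⟨u, hu, ?_⟩
  have := congr_arg (map K.subtype) e
  rwa [map_conj_smul, map_subgroupOf_eq_of_le hQK, map_subgroupOf_eq_of_le hRK] at this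

theorem coprime_natCard_of_isPGroup [Finite G] {p : ℕ} [Fact p.Prime] {N Q : Subgroup G}
    (hN : IsPGroup p N) (hQ : p.Coprime (Nat.card Q)) : (Nat.card N).Coprime (Nat.card Q) := by
  obtain ⟨n, hn⟩ := IsPGroup.iff_card.1 hN
  rw [hn]
  exact hQ.pow_left n

end SchurZassenhausConjugacy

universe u v

/-- **Schur–Zassenhaus**, conjugacy part, for a normal `p`-subgroup given as a kernel. -/
theorem exists_conj_smul_eq_of_map_eq {p : ℕ} [Fact p.Prime] {G : Type u} {L : Type v} [Group G]
    [Group L] [Finite G] (f : G →* L) (hf : IsPGroup p f.ker) {Q R : Subgroup G}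
    (hQ : p.Coprime (Nat.card Q)) (hR : p.Coprime (Nat.card R)) (h : Q.map f = R.map f) :
    ∃ u ∈ f.ker, MulAut.conj u • Q = R := by
  induction hn : Nat.card G using Nat.strong_induction_on generalizing G with
  | _ n ih =>
  by_cases htriv : f.ker = ⊥
  · refine ⟨1, one_mem _, ?_⟩
    rw [map_one, one_smul]
    exact map_injective ((MonoidHom.ker_eq_bot_iff f).1 htriv) h
  -- The centre of the kernel is abelian, normal in `G`, and nontrivial because the kernel is a
  -- nontrivial `p`-group. Induction conjugates the subgroups modulo `A`; the commutative case then
  -- finishes.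
  let A : Subgroup G := (center f.ker).map f.ker.subtype
  have hAle : A ≤ f.ker := map_subtype_le _
  have hAp : IsPGroup p A := hf.to_le hAle
  have hAcomm : IsMulCommutative A := inferInstance
  have hA : A ≠ ⊥ := by
    have : Nontrivial f.ker := (nontrivial_iff_ne_bot _).2 htriv
    have := hf.center_nontrivial
    rw [Ne, map_eq_bot_iff_of_injective _ f.ker.subtype_injective]
    exact (nontrivial_iff_ne_bot _).1 this
  let fbar : G ⧸ A →* L := QuotientGroup.lift A f hAle
  have hcomp : fbar.comp (QuotientGroup.mk' A) = f := by ext; rfl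
  have hker : fbar.ker = f.ker.map (QuotientGroup.mk' A) := QuotientGroup.ker_lift A f hAle
  have hcard : ∀ S : Subgroup G, p.Coprime (Nat.card S) →
      p.Coprime (Nat.card (S.map (QuotientGroup.mk' A))) :=
    fun S hS => hS.coprime_dvd_right (card_map_dvd _ _)
  have hlt : Nat.card (G ⧸ A) < n := by
    rw [← hn, card_eq_card_quotient_mul_card_subgroup A]
    exact lt_mul_of_one_lt_right Nat.card_pos
      (Finite.one_lt_card_iff_nontrivial.2 ((nontrivial_iff_ne_bot _).2 hA))
  obtain ⟨w, hw, e⟩ := ih _ hlt fbar (hker ▸ hf.map _) (hcard Q hQ) (hcard R hR)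
    (by rw [map_map, map_map, hcomp, h]) rfl
  obtain ⟨w, hw', rfl⟩ := (hker ▸ hw : w ∈ f.ker.map (QuotientGroup.mk' A))
  rw [← map_conj_smul] at e
  obtain ⟨v, hv, e'⟩ := exists_conj_smul_eq_of_map_mk_eq
    (coprime_natCard_of_isPGroup hAp (by rwa [card_conj_smul]))
    (coprime_natCard_of_isPGroup hAp hR) e
  exact ⟨v * w, mul_mem (hAle hv) hw', by rw [map_mul, mul_smul, e']⟩

end Subgroup

/-! ### Finite nilpotent groups -/

section Nilpotent

variable {G : Type*} [Group G]

/-- The group is the product of its Sylow subgroups. In each factor the two components have coprime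
orders that are powers of one prime, so one of them is trivial. -/
theorem commute_of_isNilpotent_of_coprime [Finite G] [Group.IsNilpotent G] {x y : G}
    (h : (orderOf x).Coprime (orderOf y)) : Commute x y := by
  obtain ⟨e⟩ := ((Group.isNilpotent_of_finite_tfae (G := G)).out 0 4).1 ‹_›
  have key : Commute (e.symm x) (e.symm y) := by
    ext q P
    have hq : Fact (q : ℕ).Prime := ⟨Nat.prime_of_mem_primeFactors q.2⟩
    let φ : G →* P :=
      ((Pi.evalMonoidHom _ P).comp (Pi.evalMonoidHom _ q)).comp e.symm.toMonoidHom
    have hφ : Commute (φ x) (φ y) := by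
      obtain ⟨a, ha⟩ := (IsPGroup.iff_orderOf.1 P.isPGroup') (φ x)
      obtain ⟨b, hb⟩ := (IsPGroup.iff_orderOf.1 P.isPGroup') (φ y)
      have hcop : ((q : ℕ) ^ a).Coprime ((q : ℕ) ^ b) := by
        rw [← ha, ← hb]
        exact Nat.Coprime.of_dvd (orderOf_map_dvd φ x) (orderOf_map_dvd φ y) h
      rcases Nat.eq_zero_or_pos a with rfl | ha0
      · rw [pow_zero, orderOf_eq_one_iff] at ha
        exact ha ▸ Commute.one_left _
      rcases Nat.eq_zero_or_pos b with rfl | hb0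
      · rw [pow_zero, orderOf_eq_one_iff] at hb
        exact hb ▸ Commute.one_right _
      have := (Nat.coprime_pow_left_iff ha0 _ _).1 ((Nat.coprime_pow_right_iff hb0 _ _).1 hcop)
      exact absurd ((Nat.coprime_self _).1 this) hq.out.ne_one
    exact congr_arg Subtype.val hφ
  simpa using key.map e

namespace Subgroup

/-- A self-normalizing subgroup of a nilpotent subgroup is the whole of it. -/
theorem eq_of_normalizer_eq_of_le {D E : Subgroup G} (hE : Group.IsNilpotent E) (hDE : D ≤ E)
    (hD : normalizer (D : Set G) = D) : D = E := by
  refine le_antisymm hDE (subgroupOf_eq_top.1 ?_)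
  refine normalizerCondition_iff_only_full_group_self_normalizing.1
    Group.normalizerCondition_of_isNilpotent _ (le_antisymm (fun x hx => ?_) le_normalizer)
  rw [mem_subgroupOf, ← hD, mem_normalizer_iff]
  intro y
  rw [mem_normalizer_iff] at hx
  constructor
  · intro hy
    exact (hx ⟨y, hDE hy⟩).1 hy
  · intro hy
    have : y ∈ E := by
      have h1 := E.mul_mem (E.mul_mem (E.inv_mem x.2) (hDE hy)) x.2
      simpa [mul_assoc] using h1
    exact (hx ⟨y, this⟩).2 hy

end Subgroup

end Nilpotent

/-! ### Carter subgroups over a normal `p`-subgroup -/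

section PrimeKernel

open Subgroup

variable {G L : Type*} [Group G] [Group L] {f : G →* L}

/-- The subgroup generated by `Q` and the elements of the kernel of `f` that centralize `Q`. -/
def centralizerExtension (f : G →* L) (Q : Subgroup G) : Subgroup G :=
  Q ⊔ (f.ker ⊓ centralizer (Q : Set G))

theorem le_centralizerExtension (f : G →* L) (Q : Subgroup G) : Q ≤ centralizerExtension f Q :=
  le_sup_left

theorem mem_centralizerExtension {Q : Subgroup G} {x : G} :
    x ∈ centralizerExtension f Q ↔
      ∃ q ∈ Q, ∃ u ∈ f.ker ⊓ centralizer (Q : Set G), q * u = x := by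
  -- `Q` centralizes the second factor, so the join is the product set.
  have hle : Q ≤ normalizer (f.ker ⊓ centralizer (Q : Set G) : Subgroup G) := by
    exact le_trans (le_centralizer_iff.1 (inf_le_right (a := f.ker))) (centralizer_le_normalizer _)
  rw [← SetLike.mem_coe, centralizerExtension, coe_mul_of_left_le_normalizer_right _ _ hle,
    Set.mem_mul]
  rfl

theorem map_centralizerExtension (f : G →* L) (Q : Subgroup G) :
    (centralizerExtension f Q).map f = Q.map f := by
  rw [centralizerExtension, Subgroup.map_sup, sup_eq_left, (Subgroup.map_eq_bot_iff _).2 inf_le_left]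
  exact bot_le

theorem conj_smul_centralizer (g : G) (Q : Subgroup G) :
    MulAut.conj g • centralizer (Q : Set G) =
      centralizer ((MulAut.conj g • Q : Subgroup G) : Set G) := by
  ext x
  simp only [mem_conj_smul_iff, mem_centralizer_iff, SetLike.mem_coe]
  constructor
  · intro h y hy
    have := congr_arg (fun z => g * z * g⁻¹) (h _ hy)
    simpa [mul_assoc] using this
  · intro h y hy
    have := h (g * y * g⁻¹) (by simpa [mul_assoc] using hy)
    have := congr_arg (fun z => g⁻¹ * z * g) this
    simpa [mul_assoc] using this

theorem conj_smul_centralizerExtension (g : G) (Q : Subgroup G) :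
    MulAut.conj g • centralizerExtension f Q = centralizerExtension f (MulAut.conj g • Q) := by
  rw [centralizerExtension, centralizerExtension, smul_sup, smul_inf, conj_smul_centralizer,
    Normal.conj_smul_eq_self g f.ker]

theorem IsCarterSubgroup.conj_smul {C : Subgroup G} (hC : IsCarterSubgroup C) (g : G) :
    IsCarterSubgroup (MulAut.conj g • C) := by
  refine ⟨?_, le_antisymm (fun x hx => ?_) le_normalizer⟩
  · have := hC.1
    exact Group.nilpotent_of_mulEquiv (equivSMul (MulAut.conj g) C)
  · rw [mem_conj_smul_iff, ← hC.2, mem_normalizer_iff_conj_smul_eq]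
    rw [mem_normalizer_iff_conj_smul_eq] at hx
    rw [map_mul, map_mul, map_inv, mul_smul, mul_smul, hx, inv_smul_smul]

variable {p : ℕ} [hp : Fact p.Prime] [Finite G]

/-- Working inside `Z` puts the conjugating element in `Z`. -/
theorem exists_conj_smul_eq_of_map_eq_of_le (hf : IsPGroup p f.ker) {Z Q R : Subgroup G}
    (hQ : p.Coprime (Nat.card Q)) (hR : p.Coprime (Nat.card R)) (hQZ : Q ≤ Z) (hRZ : R ≤ Z)
    (h : Q.map f = R.map f) : ∃ u ∈ f.ker ⊓ Z, MulAut.conj u • Q = R := by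
  have hker : IsPGroup p (f.comp Z.subtype).ker := by
    rw [← MonoidHom.comap_ker]
    exact hf.comap_of_injective _ Z.subtype_injective
  obtain ⟨u, hu, e⟩ := exists_conj_smul_eq_of_map_eq (f.comp Z.subtype) hker
    (Q := Q.subgroupOf Z) (R := R.subgroupOf Z)
    (by rwa [Nat.card_congr (subgroupOfEquivOfLe hQZ).toEquiv])
    (by rwa [Nat.card_congr (subgroupOfEquivOfLe hRZ).toEquiv])
    (by rw [← map_map, ← map_map, map_subgroupOf_eq_of_le hQZ, map_subgroupOf_eq_of_le hRZ, h])
  refine ⟨u, ⟨hu, u.2⟩, ?_⟩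
  have := congr_arg (map Z.subtype) e
  rwa [map_conj_smul, map_subgroupOf_eq_of_le hQZ, map_subgroupOf_eq_of_le hRZ] at this

theorem eq_of_map_eq_of_coprime (hf : IsPGroup p f.ker) {Q : Subgroup G}
    (hQ : p.Coprime (Nat.card Q)) {x y : G} (hx : x ∈ Q) (hy : y ∈ Q) (h : f x = f y) : x = y := by
  have hd := disjoint_of_coprime_natCard (coprime_natCard_of_isPGroup hf hQ)
  have : x * y⁻¹ ∈ f.ker ⊓ Q := ⟨MonoidHom.mem_ker.2 (by simp [h]), Q.mul_mem hx (Q.inv_mem hy)⟩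
  rw [hd.eq_bot, mem_bot] at this
  exact mul_inv_eq_one.1 this

/-- A complement of the normal subgroup `K ∩ ker f` of `K`, which is a `p`-group of `p'`-index, has
the same image as `K`. -/
theorem exists_le_coprime_map_eq (hf : IsPGroup p f.ker) (hL : p.Coprime (Nat.card L))
    (K : Subgroup G) : ∃ Q ≤ K, p.Coprime (Nat.card Q) ∧ Q.map f = K.map f := by
  let k := f.comp K.subtype
  have hk : IsPGroup p k.ker := by
    rw [← MonoidHom.comap_ker]
    exact hf.comap_of_injective _ K.subtype_injective
  have hidx : p.Coprime k.ker.index := by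
    rw [index_ker]
    exact hL.coprime_dvd_right (card_subgroup_dvd_card _)
  obtain ⟨n, hn⟩ := IsPGroup.iff_card.1 hk
  obtain ⟨Q, hQ⟩ := exists_right_complement'_of_coprime (N := k.ker) (hn ▸ hidx.pow_left n)
  refine ⟨Q.map K.subtype, map_subtype_le _, ?_, ?_⟩
  · rw [card_map_of_injective K.subtype_injective, ← hQ.symm.index_eq_card]
    exact hidx
  · have h1 : (k.ker ⊔ Q).map k = Q.map k := by
      rw [Subgroup.map_sup, (Subgroup.map_eq_bot_iff _).2 le_rfl, bot_sup_eq]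
    rw [hQ.sup_eq_top] at h1
    rw [map_map, ← h1, ← MonoidHom.range_eq_map, MonoidHom.range_comp, range_subtype]

theorem exists_le_coprime_map_eq_of_le (hf : IsPGroup p f.ker) (hL : p.Coprime (Nat.card L))
    {K Y : Subgroup G} (hY : p.Coprime (Nat.card Y)) (hYK : Y ≤ K) :
    ∃ Q ≤ K, Y ≤ Q ∧ p.Coprime (Nat.card Q) ∧ Q.map f = K.map f := by
  obtain ⟨Q, hQK, hQ, hQf⟩ := exists_le_coprime_map_eq hf hL K
  -- The part of `Q` lying over `f(Y)` is conjugate to `Y` under the kernel; the same conjugation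
  -- moves `Q` to a subgroup containing `Y`.
  let R := Q ⊓ (Y.map f).comap f
  have hRf : R.map f = Y.map f := by
    apply le_antisymm
    · rintro _ ⟨x, ⟨-, hx⟩, rfl⟩
      exact hx
    · rintro _ ⟨y, hy, rfl⟩
      obtain ⟨q, hq, h⟩ := (hQf ▸ mem_map_of_mem f (hYK hy) : f y ∈ Q.map f)
      exact ⟨q, ⟨hq, y, hy, h.symm⟩, h⟩
  obtain ⟨u, hu, e⟩ := exists_conj_smul_eq_of_map_eq_of_le hf (Z := K)
    (hQ.coprime_dvd_right (card_dvd_of_le inf_le_left)) hY (inf_le_left.trans hQK) hYK hRf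
  refine ⟨MulAut.conj u • Q, ?_, ?_, by rwa [card_conj_smul], ?_⟩
  · intro x hx
    rw [mem_conj_smul_iff] at hx
    have := K.mul_mem (K.mul_mem hu.2 (hQK hx)) (K.inv_mem hu.2)
    simpa [mul_assoc] using this
  · rw [← e]
    exact smul_mono_right _ inf_le_left
  · rw [map_conj_smul, (MonoidHom.mem_ker).1 hu.1, map_one, one_smul, hQf]

theorem ker_inf_centralizerExtension (hf : IsPGroup p f.ker) {Q : Subgroup G}
    (hQ : p.Coprime (Nat.card Q)) :
    f.ker ⊓ centralizerExtension f Q = f.ker ⊓ centralizer (Q : Set G) := by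
  refine le_antisymm ?_ (le_inf inf_le_left le_sup_right)
  rintro x ⟨hx, hx'⟩
  obtain ⟨q, hq, u, hu, rfl⟩ := mem_centralizerExtension.1 hx'
  have : q = 1 := eq_of_map_eq_of_coprime hf hQ hq (one_mem Q) (by
    rw [map_one]
    exact ((f.ker.mul_mem_cancel_right hu.1).1 hx : q ∈ f.ker))
  rwa [this, one_mul]

/-- Write `y = q * u` with commuting factors. Then `y ^ |Q| = u ^ |Q|` lies in `Y ∩ ker f = 1`, and
the `p`-element `u` must be trivial. This is why `Q` can be recovered from `Q C_P(Q)`. -/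
theorem le_of_le_centralizerExtension (hf : IsPGroup p f.ker) {Q Y : Subgroup G}
    (hQ : p.Coprime (Nat.card Q)) (hY : p.Coprime (Nat.card Y))
    (h : Y ≤ centralizerExtension f Q) : Y ≤ Q := by
  intro y hy
  obtain ⟨q, hq, u, hu, rfl⟩ := mem_centralizerExtension.1 (h hy)
  have hcomm : Commute q u := hu.2 q hq
  have hpow : (q * u) ^ Nat.card Q = u ^ Nat.card Q := by
    have hq1 : q ^ Nat.card Q = 1 := orderOf_dvd_iff_pow_eq_one.1 (Q.orderOf_dvd_natCard hq)
    rw [hcomm.mul_pow, hq1, one_mul]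
  have h1 : u ^ Nat.card Q = 1 := by
    rw [← hpow]
    refine eq_of_map_eq_of_coprime hf hY (pow_mem hy _) (one_mem Y) ?_
    rw [hpow, map_pow, (MonoidHom.mem_ker).1 hu.1, one_pow, map_one]
  have h2 : orderOf u = 1 := by
    obtain ⟨n, hn⟩ := IsPGroup.iff_orderOf.1 hf ⟨u, hu.1⟩
    rw [orderOf_mk] at hn
    exact Nat.eq_one_of_dvd_coprimes (hQ.pow_left n) (hn ▸ dvd_rfl) (orderOf_dvd_of_pow_eq_one h1)
  rwa [orderOf_eq_one_iff.1 h2, mul_one]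

theorem centralizerExtension_injOn (hf : IsPGroup p f.ker) {Q R : Subgroup G}
    (hQ : p.Coprime (Nat.card Q)) (hR : p.Coprime (Nat.card R))
    (h : centralizerExtension f Q = centralizerExtension f R) : Q = R :=
  le_antisymm (le_of_le_centralizerExtension hf hR hQ (h ▸ le_centralizerExtension f Q))
    (le_of_le_centralizerExtension hf hQ hR (h ▸ le_centralizerExtension f R))

theorem isNilpotent_centralizerExtension (hf : IsPGroup p f.ker) {Q : Subgroup G}
    (hQ : Group.IsNilpotent Q) : Group.IsNilpotent (centralizerExtension f Q) := by
  let C := f.ker ⊓ centralizer (Q : Set G)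
  have hC : Group.IsNilpotent C := (hf.to_le inf_le_left).isNilpotent
  let φ : Q × C →* G := Q.subtype.noncommCoprod C.subtype (fun q u => (mem_inf.1 u.2).2 q q.2)
  have hφ : φ.range = centralizerExtension f Q := by
    refine (MonoidHom.noncommCoprod_range _ _ _).trans ?_
    rw [range_subtype, range_subtype, centralizerExtension]
  rw [← hφ]
  exact Group.nilpotent_of_surjective φ.rangeRestrict φ.rangeRestrict_surjective

theorem mem_centralizer_of_mem_normalizer (hf : IsPGroup p f.ker) {Q : Subgroup G}
    (hQ : p.Coprime (Nat.card Q)) {u : G} (hu : u ∈ f.ker) (h : MulAut.conj u • Q = Q) :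
    u ∈ centralizer (Q : Set G) := by
  intro x hx
  have h1 : u * x * u⁻¹ ∈ Q := h ▸ conj_mem_conj_smul hx
  have h2 : u * x * u⁻¹ = x := eq_of_map_eq_of_coprime hf hQ h1 hx (by
    simp [(MonoidHom.mem_ker).1 hu])
  exact (mul_inv_eq_iff_eq_mul.1 h2).symm

theorem isCarterSubgroup_centralizerExtension (hf : IsPGroup p f.ker) {Q : Subgroup G}
    (hQ : p.Coprime (Nat.card Q)) (hC : IsCarterSubgroup (Q.map f)) :
    IsCarterSubgroup (centralizerExtension f Q) := by
  have hinj : Function.Injective (f.subgroupMap Q) := fun x y h =>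
    Subtype.ext (eq_of_map_eq_of_coprime hf hQ x.2 y.2 (congr_arg Subtype.val h))
  have hQn : Group.IsNilpotent Q := by
    have := hC.1
    exact Group.nilpotent_of_mulEquiv
      (MulEquiv.ofBijective _ ⟨hinj, f.subgroupMap_surjective Q⟩).symm
  refine ⟨isNilpotent_centralizerExtension hf hQn, le_antisymm (fun g hg => ?_) le_normalizer⟩
  rw [mem_normalizer_iff_conj_smul_eq] at hg
  -- Since `Q` is determined by its extension, normalizing the extension means normalizing `Q`.
  have hgQ : MulAut.conj g • Q = Q := by
    rw [conj_smul_centralizerExtension] at hg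
    exact centralizerExtension_injOn hf (by rwa [card_conj_smul]) hQ hg
  have hfg : f g ∈ Q.map f := by
    rw [← hC.2, mem_normalizer_iff_conj_smul_eq, ← map_conj_smul, hgQ]
  obtain ⟨q, hq, hqg⟩ := hfg
  refine mem_centralizerExtension.2 ⟨q, hq, q⁻¹ * g, ?_, mul_inv_cancel_left q g⟩
  have hker : q⁻¹ * g ∈ f.ker := by simp [MonoidHom.mem_ker, hqg]
  refine ⟨hker, mem_centralizer_of_mem_normalizer hf hQ hker ?_⟩
  rw [map_mul, mul_smul, hgQ]
  exact mem_normalizer_iff_conj_smul_eq.1 (le_normalizer (inv_mem hq))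

/-- Take for `Q` a `p'`-subgroup of `D` with full image. Nilpotency makes the `p`-elements of `D`
commute with `Q`, so `D` is contained in the nilpotent group `Q C_P(Q)`; being self-normalizing, `D`
is all of it. -/
theorem IsCarterSubgroup.exists_eq_centralizerExtension (hf : IsPGroup p f.ker)
    (hL : p.Coprime (Nat.card L)) (hsurj : Function.Surjective f) {D : Subgroup G}
    (hD : IsCarterSubgroup D) :
    ∃ Q : Subgroup G, p.Coprime (Nat.card Q) ∧ IsCarterSubgroup (Q.map f) ∧
      centralizerExtension f Q = D := by
  obtain ⟨Q, hQD, hQ, hQf⟩ := exists_le_coprime_map_eq hf hL D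
  have hDn := hD.1
  have hQn : Group.IsNilpotent Q :=
    Group.nilpotent_of_mulEquiv (subgroupOfEquivOfLe hQD)
  have hDE : D ≤ centralizerExtension f Q := by
    intro d hd
    obtain ⟨q, hq, hqd⟩ := (hQf ▸ mem_map_of_mem f hd : f d ∈ Q.map f)
    have hker : q⁻¹ * d ∈ f.ker := by simp [MonoidHom.mem_ker, hqd]
    refine mem_centralizerExtension.2 ⟨q, hq, q⁻¹ * d, ⟨hker, fun x hx => ?_⟩,
      mul_inv_cancel_left q d⟩
    have hmem : q⁻¹ * d ∈ D := mul_mem (inv_mem (hQD hq)) hd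
    have hcop : (orderOf x).Coprime (orderOf (q⁻¹ * d)) := by
      obtain ⟨n, hn⟩ := IsPGroup.iff_orderOf.1 hf ⟨_, hker⟩
      rw [orderOf_mk] at hn
      rw [hn]
      exact ((hQ.coprime_dvd_right (Q.orderOf_dvd_natCard hx)).pow_left n).symm
    have := commute_of_isNilpotent_of_coprime (x := (⟨x, hQD hx⟩ : D)) (y := ⟨_, hmem⟩)
      (by rwa [orderOf_mk, orderOf_mk])
    exact congr_arg Subtype.val this
  have hE := eq_of_normalizer_eq_of_le (isNilpotent_centralizerExtension hf hQn) hDE hD.2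
  refine ⟨Q, hQ, ⟨Group.nilpotent_of_surjective _ (f.subgroupMap_surjective Q),
    le_antisymm (fun l hl => ?_) le_normalizer⟩, hE.symm⟩
  obtain ⟨g, rfl⟩ := hsurj l
  rw [mem_normalizer_iff_conj_smul_eq, ← map_conj_smul] at hl
  -- Frattini argument: `g` is corrected by a kernel element so that it normalizes `Q`, hence `D`.
  obtain ⟨u, hu, e⟩ := exists_conj_smul_eq_of_map_eq f hf (by rwa [card_conj_smul]) hQ hl
  rw [← mul_smul, ← map_mul] at e
  have hug : u * g ∈ D := by
    rw [← hD.2, mem_normalizer_iff_conj_smul_eq, hE, conj_smul_centralizerExtension, e]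
  have := mem_map_of_mem f hug
  rwa [map_mul, (MonoidHom.mem_ker).1 hu, one_mul, ← hQf] at this

end PrimeKernel

/-! ### Counting Carter subgroups -/

open Subgroup

theorem Nat.card_eq_card_mul_of_forall_card_fiber_eq {α β : Type*} [Finite α] [Finite β] (φ : α → β) {m : ℕ}
    (h : ∀ b, Nat.card {a // φ a = b} = m) : Nat.card α = Nat.card β * m := by
  have := Fintype.ofFinite β
  rw [Nat.card_congr (Equiv.sigmaFiberEquiv φ).symm, Nat.card_sigma]
  simp [h, Nat.card_eq_fintype_card]

namespace IsCarterSubgroup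

variable {G : Type*} [Group G]

theorem subgroupOf {R : Subgroup G} (hR : IsCarterSubgroup R) {W : Subgroup G} (hRW : R ≤ W) :
    IsCarterSubgroup (R.subgroupOf W) := by
  have := hR.1
  refine ⟨Group.nilpotent_of_mulEquiv (subgroupOfEquivOfLe hRW).symm,
    le_antisymm (fun x hx => ?_) le_normalizer⟩
  rw [mem_normalizer_iff_conj_smul_eq] at hx
  rw [mem_subgroupOf, ← hR.2, mem_normalizer_iff_conj_smul_eq]
  have := congr_arg (map W.subtype) hx
  rwa [map_conj_smul, map_subgroupOf_eq_of_le hRW] at this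

end IsCarterSubgroup

/-- If the Carter subgroups of `W` are conjugate and `W` contains a Carter subgroup of `G`, then
the Carter subgroups of `W` are the Carter subgroups of `G` contained in `W`. -/
theorem natCard_isCarterSubgroup_le_eq_carterCount {G : Type*} [Group G] {W R₀ Y : Subgroup G}
    (hR₀ : IsCarterSubgroup R₀) (hRW : R₀ ≤ W) (hY : Y ≤ W)
    (hconj : ∀ C D : Subgroup W, IsCarterSubgroup C → IsCarterSubgroup D →
      ∃ g : W, MulAut.conj g • C = D) :
    Nat.card {R : Subgroup G // IsCarterSubgroup R ∧ Y ≤ R ∧ R ≤ W} =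
      carterCount (Y.subgroupOf W) := by
  refine Nat.card_congr (Equiv.ofBijective (fun R =>
    ⟨R.1.subgroupOf W, R.2.1.subgroupOf R.2.2.2, comap_mono R.2.2.1⟩) ⟨?_, ?_⟩)
  · rintro ⟨R, hR⟩ ⟨S, hS⟩ h
    have := congr_arg (map W.subtype) (congr_arg Subtype.val h)
    simp only [map_subgroupOf_eq_of_le hR.2.2, map_subgroupOf_eq_of_le hS.2.2] at this
    exact Subtype.ext this
  · rintro ⟨S, hS, hYS⟩
    -- Conjugacy is essential here: being self-normalizing in `W` does not by itself imply being
    -- self-normalizing in `G`.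
    obtain ⟨g, rfl⟩ := hconj _ _ (hR₀.subgroupOf hRW) hS
    have hmap : (MulAut.conj g • R₀.subgroupOf W).map W.subtype = MulAut.conj (g : G) • R₀ := by
      rw [map_conj_smul, map_subgroupOf_eq_of_le hRW]
      rfl
    refine ⟨⟨(MulAut.conj g • R₀.subgroupOf W).map W.subtype, ?_, ?_, map_subtype_le _⟩, ?_⟩
    · rw [hmap]
      exact hR₀.conj_smul _
    · rw [← map_subgroupOf_eq_of_le hY]
      exact map_mono hYS
    · exact Subtype.ext (comap_map_eq_self_of_injective W.subtype_injective _)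

section PrimeKernel

variable {p : ℕ} [hp : Fact p.Prime] {G L : Type*} [Group G] [Group L] [Finite G] {f : G →* L}

/-- The `p'`-subgroups between `Y` and `Z` with a given image are permuted transitively by the
elements of the kernel in `Z` that centralize `Y`. -/
theorem natCard_coprime_map_eq (hf : IsPGroup p f.ker) {Y Z Q : Subgroup G}
    (hQ : p.Coprime (Nat.card Q)) (hYQ : Y ≤ Q) (hQZ : Q ≤ Z) :
    Nat.card {R : Subgroup G // p.Coprime (Nat.card R) ∧ Y ≤ R ∧ R ≤ Z ∧ R.map f = Q.map f} =
      (centralizer (Q : Set G)).relIndex (f.ker ⊓ Z ⊓ centralizer (Y : Set G)) := by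
  set B := f.ker ⊓ Z ⊓ centralizer (Y : Set G)
  let _ : MulAction B (Subgroup G) := MulAction.compHom _ (MulAut.conj.comp B.subtype)
  have hsmul : ∀ (u : B) (S : Subgroup G), u • S = MulAut.conj (u : G) • S := fun _ _ => rfl
  have hstab : MulAction.stabilizer B Q = (centralizer (Q : Set G)).subgroupOf B := by
    ext u
    rw [MulAction.mem_stabilizer_iff, hsmul, mem_subgroupOf]
    exact ⟨mem_centralizer_of_mem_normalizer hf hQ u.2.1.1, fun h =>
      mem_normalizer_iff_conj_smul_eq.1 (centralizer_le_normalizer _ h)⟩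
  have horbit : MulAction.orbit B Q =
      {R : Subgroup G | p.Coprime (Nat.card R) ∧ Y ≤ R ∧ R ≤ Z ∧ R.map f = Q.map f} := by
    ext R
    constructor
    · rintro ⟨u, rfl⟩
      change _ ∧ _
      simp only [hsmul]
      refine ⟨by rwa [card_conj_smul], fun y hy => ?_, fun x hx => ?_, ?_⟩
      · have h1 : y * u = u * y := u.2.2 y hy
        rw [mem_conj_smul_iff, mul_assoc, h1, inv_mul_cancel_left]
        exact hYQ hy
      · rw [mem_conj_smul_iff] at hx
        have := Z.mul_mem (Z.mul_mem u.2.1.2 (hQZ hx)) (Z.inv_mem u.2.1.2)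
        simpa [mul_assoc] using this
      · rw [map_conj_smul, MonoidHom.mem_ker.1 u.2.1.1, map_one, one_smul]
    · rintro ⟨hR, hYR, hRZ, h⟩
      obtain ⟨u, hu, e⟩ := exists_conj_smul_eq_of_map_eq_of_le hf hQ hR hQZ hRZ h.symm
      -- The conjugating element centralizes `Y`: `u * y * u⁻¹` and `y` have the same image and both
      -- lie in `R`, on which `f` is injective.
      refine ⟨⟨u, hu, fun y hy => ?_⟩, e⟩
      have h1 : u * y * u⁻¹ ∈ R := e ▸ conj_mem_conj_smul (hYQ hy)
      have h2 : u * y * u⁻¹ = y := eq_of_map_eq_of_coprime hf hR h1 (hYR hy) (by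
        simp [MonoidHom.mem_ker.1 hu.1])
      exact (mul_inv_eq_iff_eq_mul.1 h2).symm
  rw [relIndex, ← hstab, MulAction.index_stabilizer, horbit]
  rfl

theorem relIndex_mul_natCard_inf {G : Type*} [Group G] (H K : Subgroup G) :
    H.relIndex K * Nat.card ↥(H ⊓ K) = Nat.card K := by
  rw [← inf_relIndex_right, relIndex,
    ← Nat.card_congr (subgroupOfEquivOfLe (inf_le_right (a := H) (b := K))).toEquiv,
    index_mul_card]

/-- Conjugate images yield equally many conjugates. -/
theorem relIndex_centralizer_eq (hf : IsPGroup p f.ker) {Y Z Q R : Subgroup G}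
    (hQ : p.Coprime (Nat.card Q)) (hR : p.Coprime (Nat.card R)) (hYQ : Y ≤ Q) (hYR : Y ≤ R)
    (hQZ : Q ≤ Z) (hRZ : R ≤ Z) {z : G} (hz : z ∈ Z)
    (h : MulAut.conj (f z) • Q.map f = R.map f) :
    (centralizer (Q : Set G)).relIndex (f.ker ⊓ Z ⊓ centralizer (Y : Set G)) =
      (centralizer (R : Set G)).relIndex (f.ker ⊓ Z ⊓ centralizer (Y : Set G)) := by
  -- The intersection does not depend on `Y`, so an element of `Z` carrying `Q` to `R` carries one
  -- intersection to the other.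
  have hinf : ∀ S : Subgroup G, Y ≤ S →
      centralizer (S : Set G) ⊓ (f.ker ⊓ Z ⊓ centralizer (Y : Set G)) =
        f.ker ⊓ Z ⊓ centralizer (S : Set G) := fun S hS => by
    rw [inf_comm, inf_assoc, inf_eq_right.2 (centralizer_le (SetLike.coe_subset_coe.2 hS))]
  have hzle : ∀ (S : Subgroup G) {w : G}, S ≤ Z → w ∈ Z → MulAut.conj w • S ≤ Z := by
    intro S w hS hw x hx
    rw [mem_conj_smul_iff] at hx
    have := Z.mul_mem (Z.mul_mem hw (hS hx)) (Z.inv_mem hw)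
    simpa [mul_assoc] using this
  obtain ⟨u, hu, e⟩ := exists_conj_smul_eq_of_map_eq_of_le hf (Q := MulAut.conj z • Q)
    (by rwa [card_conj_smul]) hR (hzle Q hQZ hz) hRZ (by rw [map_conj_smul, h])
  rw [← mul_smul, ← map_mul] at e
  have hZ : MulAut.conj (u * z) • Z = Z :=
    mem_normalizer_iff_conj_smul_eq.1 (le_normalizer (mul_mem hu.2 hz))
  have hcard : Nat.card ↥(f.ker ⊓ Z ⊓ centralizer (Q : Set G)) =
      Nat.card ↥(f.ker ⊓ Z ⊓ centralizer (R : Set G)) := by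
    rw [← card_conj_smul (u * z), smul_inf, smul_inf, conj_smul_centralizer, hZ, e,
      Normal.conj_smul_eq_self _ f.ker]
  have h1 := relIndex_mul_natCard_inf (centralizer (Q : Set G))
    (f.ker ⊓ Z ⊓ centralizer (Y : Set G))
  rw [← relIndex_mul_natCard_inf (centralizer (R : Set G))
    (f.ker ⊓ Z ⊓ centralizer (Y : Set G)), hinf Q hYQ, hinf R hYR, hcard] at h1
  exact Nat.eq_of_mul_eq_mul_right Nat.card_pos h1

theorem natCard_isCarterSubgroup_map_eq_mul (hf : IsPGroup p f.ker)
    (hL : p.Coprime (Nat.card L)) {Y Z Q₀ : Subgroup G}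
    (hQ₀ : p.Coprime (Nat.card Q₀)) (hYQ : Y ≤ Q₀) (hQZ : Q₀ ≤ Z)
    (hconj : ∀ R : Subgroup L, IsCarterSubgroup R → R ≤ Z.map f →
      ∃ z ∈ Z, MulAut.conj (f z) • Q₀.map f = R) :
    Nat.card {Q : Subgroup G //
        p.Coprime (Nat.card Q) ∧ IsCarterSubgroup (Q.map f) ∧ Y ≤ Q ∧ Q ≤ Z} =
      Nat.card {R : Subgroup L // IsCarterSubgroup R ∧ Y.map f ≤ R ∧ R ≤ Z.map f} *
        (centralizer (Q₀ : Set G)).relIndex (f.ker ⊓ Z ⊓ centralizer (Y : Set G)) := by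
  have : Finite L := Nat.finite_of_card_ne_zero fun h => by
    rw [h, Nat.coprime_zero_right] at hL
    exact hp.out.ne_one hL
  have hY : p.Coprime (Nat.card Y) := hQ₀.coprime_dvd_right (card_dvd_of_le hYQ)
  refine Nat.card_eq_card_mul_of_forall_card_fiber_eq
    (fun Q => ⟨Q.1.map f, Q.2.2.1, map_mono Q.2.2.2.1, map_mono Q.2.2.2.2⟩) ?_
  rintro ⟨R, hR, hYR, hRZ⟩
  -- A base point in the fibre over `R`; conjugacy of `R` with `f(Q₀)` makes the size of the fibre
  -- independent of `R`.
  obtain ⟨Q, hQK, hYQ', hQ, hQf⟩ := exists_le_coprime_map_eq_of_le hf hL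
    (K := R.comap f ⊓ Z) hY (le_inf (map_le_iff_le_comap.1 hYR) (hYQ.trans hQZ))
  have hQR : Q.map f = R := by
    rw [hQf]
    apply le_antisymm
    · rintro _ ⟨x, hx, rfl⟩
      exact hx.1
    · intro r hr
      obtain ⟨z, hz, rfl⟩ := hRZ hr
      exact ⟨z, ⟨hr, hz⟩, rfl⟩
  have hQZ' : Q ≤ Z := hQK.trans inf_le_right
  obtain ⟨z, hz, e⟩ := hconj R hR hRZ
  rw [relIndex_centralizer_eq hf hQ₀ hQ hYQ hYQ' hQZ hQZ' hz (e.trans hQR.symm),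
    ← natCard_coprime_map_eq hf hQ hYQ' hQZ', hQR]
  refine Nat.card_congr ⟨fun S => ⟨S.1.1, S.1.2.1, S.1.2.2.2.1, S.1.2.2.2.2,
    congr_arg Subtype.val S.2⟩, fun S => ⟨⟨S.1, S.2.1, ?_, S.2.2.1, S.2.2.2.1⟩,
    Subtype.ext S.2.2.2.2⟩, fun _ => rfl, fun _ => rfl⟩
  rw [S.2.2.2.2]
  exact hR

/-- `X` is generated by `Y` and `X ∩ ker f`, and the latter lies in `C(Q)` exactly when `Q` lies in
its centralizer. -/
theorem le_centralizerExtension_iff (hf : IsPGroup p f.ker) {X Y Q : Subgroup G}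
    (hQ : p.Coprime (Nat.card Q)) (hY : p.Coprime (Nat.card Y)) (hYX : Y ≤ X)
    (hYf : Y.map f = X.map f) :
    X ≤ centralizerExtension f Q ↔
      Y ≤ Q ∧ Q ≤ centralizer ((X ⊓ f.ker : Subgroup G) : Set G) := by
  constructor
  · intro h
    refine ⟨le_of_le_centralizerExtension hf hQ hY (hYX.trans h), ?_⟩
    rw [le_centralizer_iff]
    refine le_trans ?_ (ker_inf_centralizerExtension hf hQ).le |>.trans inf_le_right
    exact le_inf inf_le_right (inf_le_left.trans h)
  · rintro ⟨hYQ, hQX⟩ x hx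
    obtain ⟨y, hy, h⟩ := (hYf ▸ mem_map_of_mem f hx : f x ∈ Y.map f)
    have hker : y⁻¹ * x ∈ f.ker := by simp [MonoidHom.mem_ker, h]
    exact mem_centralizerExtension.2 ⟨y, hYQ hy, y⁻¹ * x, ⟨hker, le_centralizer_iff.1 hQX
      ⟨X.mul_mem (X.inv_mem (hYX hy)) hx, hker⟩⟩, mul_inv_cancel_left y x⟩

theorem carterCount_eq_natCard (hf : IsPGroup p f.ker) (hL : p.Coprime (Nat.card L))
    (hsurj : Function.Surjective f) {X Y : Subgroup G}
    (hY : p.Coprime (Nat.card Y)) (hYX : Y ≤ X) (hYf : Y.map f = X.map f) :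
    carterCount X = Nat.card {Q : Subgroup G // p.Coprime (Nat.card Q) ∧
      IsCarterSubgroup (Q.map f) ∧ Y ≤ Q ∧
        Q ≤ centralizer ((X ⊓ f.ker : Subgroup G) : Set G)} := by
  refine (Nat.card_congr (Equiv.ofBijective (fun Q => ⟨centralizerExtension f Q.1,
    isCarterSubgroup_centralizerExtension hf Q.2.1 Q.2.2.1,
    (le_centralizerExtension_iff hf Q.2.1 hY hYX hYf).2 Q.2.2.2⟩) ⟨?_, ?_⟩)).symm
  · rintro ⟨Q, hQ⟩ ⟨R, hR⟩ h
    exact Subtype.ext (centralizerExtension_injOn hf hQ.1 hR.1 (congr_arg Subtype.val h))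
  · rintro ⟨D, hD, hXD⟩
    obtain ⟨Q, hQ, hQf, rfl⟩ := hD.exists_eq_centralizerExtension hf hL hsurj
    exact ⟨⟨Q, hQ, hQf, (le_centralizerExtension_iff hf hQ hY hYX hYf).1 hXD⟩, rfl⟩

theorem index_centralizerExtension (hf : IsPGroup p f.ker) (hsurj : Function.Surjective f)
    {Q : Subgroup G} (hQ : p.Coprime (Nat.card Q)) :
    (centralizerExtension f Q).index =
      (Q.map f).index * (centralizer (Q : Set G)).relIndex f.ker := by
  have hcard : ∀ E : Subgroup G, Nat.card E = Nat.card (E.map f) * Nat.card ↥(f.ker ⊓ E) :=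
    fun E => by rw [← relIndex_mul_natCard_inf f.ker E, relIndex_ker]
  have h1 := (centralizerExtension f Q).index_mul_card
  have h2 := hcard ⊤
  rw [inf_top_eq, card_top, ← MonoidHom.range_eq_map, MonoidHom.range_eq_top.2 hsurj, card_top,
    ← (Q.map f).index_mul_card, ← relIndex_mul_natCard_inf (centralizer (Q : Set G)) f.ker,
    inf_comm _ f.ker] at h2
  rw [h2, hcard (centralizerExtension f Q), map_centralizerExtension,
    ker_inf_centralizerExtension hf hQ] at h1
  have : Finite L := Finite.of_surjective f hsurj
  refine Nat.eq_of_mul_eq_mul_right (m := Nat.card (Q.map f) *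
    Nat.card ↥(f.ker ⊓ centralizer (Q : Set G))) (Nat.mul_pos Nat.card_pos Nat.card_pos) ?_
  rw [h1]
  ring

/-- Both relative indices are powers of `p`, so the inequality between them is a divisibility. -/
theorem IsPGroup.relIndex_dvd_relIndex {H B P : Subgroup G} (hP : IsPGroup p P) (hB : B ≤ P) :
    H.relIndex B ∣ H.relIndex P := by
  obtain ⟨a, ha⟩ := IsPGroup.iff_card.1 (hP.to_le hB)
  obtain ⟨b, hb⟩ := IsPGroup.iff_card.1 hP
  obtain ⟨k, -, hk⟩ := (Nat.dvd_prime_pow hp.out).1 (ha ▸ H.relIndex_dvd_card B)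
  obtain ⟨l, -, hl⟩ := (Nat.dvd_prime_pow hp.out).1 (hb ▸ H.relIndex_dvd_card P)
  have h := relIndex_le_of_le_right hB (H := H) FiniteIndex.index_ne_zero
  rw [hk, hl] at h ⊢
  exact pow_dvd_pow p ((Nat.pow_le_pow_iff_right hp.out.one_lt).1 h)

/-- Carter subgroups are conjugate if those of the quotient by a normal Sylow subgroup are. -/
theorem exists_conj_smul_eq_of_forall_map (hf : IsPGroup p f.ker) (hL : p.Coprime (Nat.card L))
    (hsurj : Function.Surjective f)
    (hconj : ∀ C D : Subgroup L, IsCarterSubgroup C → IsCarterSubgroup D →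
      ∃ g : L, MulAut.conj g • C = D)
    {C D : Subgroup G} (hC : IsCarterSubgroup C) (hD : IsCarterSubgroup D) :
    ∃ g : G, MulAut.conj g • C = D := by
  obtain ⟨Q, hQ, hQf, rfl⟩ := hC.exists_eq_centralizerExtension hf hL hsurj
  obtain ⟨R, hR, hRf, rfl⟩ := hD.exists_eq_centralizerExtension hf hL hsurj
  obtain ⟨l, hl⟩ := hconj _ _ hQf hRf
  obtain ⟨g, rfl⟩ := hsurj l
  rw [← map_conj_smul] at hl
  obtain ⟨u, -, e⟩ := exists_conj_smul_eq_of_map_eq f hf (by rwa [card_conj_smul]) hR hl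
  exact ⟨u * g, by rw [conj_smul_centralizerExtension, map_mul, mul_smul, e]⟩

theorem carterCount_dvd_index_of_forall_subgroup (hf : IsPGroup p f.ker)
    (hL : p.Coprime (Nat.card L)) (hsurj : Function.Surjective f)
    (hconj : ∀ (W : Subgroup L) (C D : Subgroup W), IsCarterSubgroup C → IsCarterSubgroup D →
      ∃ g : W, MulAut.conj g • C = D)
    (hdvd : ∀ (W : Subgroup L) (C : Subgroup W), IsCarterSubgroup C → ∀ X ≤ C,
      carterCount X ∣ C.index)
    {C X : Subgroup G} (hC : IsCarterSubgroup C) (hX : X ≤ C) : carterCount X ∣ C.index := by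
  obtain ⟨Q, hQ, hQf, rfl⟩ := hC.exists_eq_centralizerExtension hf hL hsurj
  obtain ⟨Y, hYX, hY, hYf⟩ := exists_le_coprime_map_eq hf hL X
  obtain ⟨hYQ, hQZ⟩ := (le_centralizerExtension_iff hf hQ hY hYX hYf).1 hX
  rw [carterCount_eq_natCard hf hL hsurj hY hYX hYf]
  set Z := centralizer ((X ⊓ f.ker : Subgroup G) : Set G)
  have hQW : Q.map f ≤ Z.map f := map_mono hQZ
  have hYW : Y.map f ≤ Z.map f := map_mono (hYQ.trans hQZ)
  rw [natCard_isCarterSubgroup_map_eq_mul hf hL hQ hYQ hQZ,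
    natCard_isCarterSubgroup_le_eq_carterCount hQf hQW hYW (hconj _),
    index_centralizerExtension hf hsurj hQ]
  · refine mul_dvd_mul ?_ (hf.relIndex_dvd_relIndex (inf_le_left.trans inf_le_left))
    exact (hdvd _ _ (hQf.subgroupOf hQW) _ (comap_mono (map_mono hYQ))).trans
      (relIndex_dvd_index_of_le hQW)
  · intro R hR hRW
    obtain ⟨⟨_, z, hz, rfl⟩, e⟩ := hconj _ _ _ (hQf.subgroupOf hQW) (hR.subgroupOf hRW)
    refine ⟨z, hz, ?_⟩
    have := congr_arg (map (Z.map f).subtype) e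
    rwa [map_conj_smul, map_subgroupOf_eq_of_le hQW, map_subgroupOf_eq_of_le hRW] at this

end PrimeKernel

-- Induction through normal Sylow subgroups

universe u

/-- Every nontrivial subgroup has a nontrivial normal Sylow subgroup. -/
def HasNormalSylowSubgroups (G : Type*) [Group G] : Prop :=
  ∀ K : Subgroup G, K ≠ ⊥ → ∃ p : ℕ, p.Prime ∧
    ∃ N : Subgroup K, N.Normal ∧ N ≠ ⊥ ∧ IsPGroup p N ∧ p.Coprime N.index

namespace HasNormalSylowSubgroups

theorem transport {K K' : Type*} [Group K] [Group K'] (e : K ≃* K')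
    (h : ∃ p : ℕ, p.Prime ∧ ∃ N : Subgroup K,
      N.Normal ∧ N ≠ ⊥ ∧ IsPGroup p N ∧ p.Coprime N.index) :
    ∃ p : ℕ, p.Prime ∧ ∃ N : Subgroup K',
      N.Normal ∧ N ≠ ⊥ ∧ IsPGroup p N ∧ p.Coprime N.index := by
  obtain ⟨p, hp, N, hN, hbot, hNp, hc⟩ := h
  refine ⟨p, hp, N.map e.toMonoidHom, hN.map _ e.surjective, ?_, hNp.map _, ?_⟩
  · rwa [Ne, map_eq_bot_iff_of_injective _ e.injective]
  · rwa [index_map_of_bijective e.bijective]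

variable {G : Type u} [Group G]

theorem of_injective {H : Type*} [Group H] (hG : HasNormalSylowSubgroups G) (i : H →* G)
    (hi : Function.Injective i) : HasNormalSylowSubgroups H := fun K hK =>
  transport (K.equivMapOfInjective i hi).symm
    (hG (K.map i) (by rwa [Ne, map_eq_bot_iff_of_injective _ hi]))

theorem exists_normal [Nontrivial G] (hG : HasNormalSylowSubgroups G) :
    ∃ p : ℕ, p.Prime ∧ ∃ N : Subgroup G,
      N.Normal ∧ N ≠ ⊥ ∧ IsPGroup p N ∧ p.Coprime N.index :=
  transport topEquiv (hG ⊤ top_ne_bot)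

/-- The quotient is isomorphic to a complement of `N`, so heredity to subgroups suffices. -/
theorem quotient (hG : HasNormalSylowSubgroups G) {N : Subgroup G} [N.Normal]
    (hN : (Nat.card N).Coprime N.index) : HasNormalSylowSubgroups (G ⧸ N) := by
  obtain ⟨H, hH⟩ := exists_left_complement'_of_coprime hN
  exact hG.of_injective (H.subtype.comp hH.QuotientMulEquiv.toMonoidHom)
    (H.subtype_injective.comp hH.QuotientMulEquiv.injective)

/-- Induction on the order: pass from all subgroups of `G ⧸ N`, with `N` a nontrivial normal Sylow
subgroup, to `G`. -/
theorem induction {motive : ∀ (G : Type u) [Group G], Prop}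
    (subsingleton : ∀ (G : Type u) [Group G] [Subsingleton G], motive G)
    (step : ∀ (G : Type u) [Group G] [Finite G] (p : ℕ) [Fact p.Prime] (N : Subgroup G)
      [N.Normal], IsPGroup p N → p.Coprime N.index → (∀ W : Subgroup (G ⧸ N), motive W) →
      motive (G ⧸ N) → motive G)
    (G : Type u) [Group G] [Finite G] (hG : HasNormalSylowSubgroups G) : motive G := by
  induction hn : Nat.card G using Nat.strong_induction_on generalizing G with
  | _ n ih =>
  rcases subsingleton_or_nontrivial G with h | h
  · exact subsingleton G
  obtain ⟨p, hp, N, hN, hbot, hNp, hc⟩ := hG.exists_normal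
  have : Fact p.Prime := ⟨hp⟩
  obtain ⟨k, hk⟩ := IsPGroup.iff_card.1 hNp
  have hQ := hG.quotient (N := N) (hk ▸ hc.pow_left k)
  have hlt : Nat.card (G ⧸ N) < n := by
    rw [← hn, card_eq_card_quotient_mul_card_subgroup N]
    exact lt_mul_of_one_lt_right Nat.card_pos
      (Finite.one_lt_card_iff_nontrivial.2 ((nontrivial_iff_ne_bot _).2 hbot))
  refine step G p N hNp hc (fun W => ?_) (ih _ hlt _ hQ rfl)
  exact ih _ ((card_le_card_group W).trans_lt hlt) _
    (hQ.of_injective W.subtype W.subtype_injective) rfl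

theorem carterCount_dvd_index [Finite G] (hG : HasNormalSylowSubgroups G) {C X : Subgroup G}
    (hC : IsCarterSubgroup C) (hX : X ≤ C) : carterCount X ∣ C.index := by
  -- Conjugacy is carried along because the divisibility step uses it in subgroups of the quotient.
  refine (induction (motive := fun G _ =>
    (∀ C D : Subgroup G, IsCarterSubgroup C → IsCarterSubgroup D →
      ∃ g : G, MulAut.conj g • C = D) ∧
    ∀ C : Subgroup G, IsCarterSubgroup C → ∀ X ≤ C, carterCount X ∣ C.index) ?_ ?_ G hG).2
    C hC X hX
  · intro G _ _
    refine ⟨fun C D _ _ => ⟨1, Subsingleton.elim _ _⟩, fun C hC X hX => ?_⟩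
    have : Nonempty {D : Subgroup G // IsCarterSubgroup D ∧ X ≤ D} := ⟨⟨C, hC, hX⟩⟩
    rw [carterCount, Nat.card_of_subsingleton (Classical.arbitrary _)]
    exact one_dvd _
  · intro G _ _ p _ N _ hNp hc hW h
    have hNp' : IsPGroup p (QuotientGroup.mk' N).ker := by rwa [QuotientGroup.ker_mk']
    exact ⟨fun C D hC hD => exists_conj_smul_eq_of_forall_map hNp' hc
      (QuotientGroup.mk'_surjective N) h.1 hC hD,
      fun C hC X hX => carterCount_dvd_index_of_forall_subgroup hNp' hc
        (QuotientGroup.mk'_surjective N) (fun W => (hW W).1) (fun W => (hW W).2) hC hX⟩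

end HasNormalSylowSubgroups

/-! ### Sylow towers and supersoluble groups -/

namespace NormalSeries

variable {G : Type u} [Group G] (S : NormalSeries G)

/-- The homomorphism from a term of a normal series, intersected with `K`, to the factor. -/
def toFactor (K : Subgroup G) (i : ℕ) : (S.term (i + 1)).subgroupOf K →* S.Factor i :=
  (QuotientGroup.mk' _).comp
    ((K.subtype.comp (Subgroup.subtype _)).codRestrict (S.term (i + 1)) fun x => x.2)

theorem mem_ker_toFactor {K : Subgroup G} {i : ℕ} {x : (S.term (i + 1)).subgroupOf K} :
    x ∈ (S.toFactor K i).ker ↔ ((x : K) : G) ∈ S.term i := by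
  rw [MonoidHom.mem_ker]
  exact QuotientGroup.eq_one_iff (N := (S.term i).subgroupOf (S.term (i + 1))) _

/-- The first step at which the image of the series becomes nontrivial. -/
theorem exists_lt_length_map_ne_bot (K : Subgroup G) {L : Type*} [Group L] [Nontrivial L]
    (g : K →* L) (hg : Function.Surjective g) :
    ∃ i < S.length, ((S.term i).subgroupOf K).map g = ⊥ ∧
      ((S.term (i + 1)).subgroupOf K).map g ≠ ⊥ := by
  classical
  have hex : ∃ i, ((S.term i).subgroupOf K).map g ≠ ⊥ := ⟨S.length, by
    rw [S.term_length, top_subgroupOf, map_top_of_surjective g hg]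
    exact top_ne_bot⟩
  have hle : Nat.find hex ≤ S.length := Nat.find_min' hex (by
    rw [S.term_length, top_subgroupOf, map_top_of_surjective g hg]
    exact top_ne_bot)
  have h0 : Nat.find hex ≠ 0 := fun h => by
    have := Nat.find_spec hex
    rw [h, S.term_zero, bot_subgroupOf, Subgroup.map_bot] at this
    exact this rfl
  obtain ⟨j, hj⟩ := Nat.exists_eq_succ_of_ne_zero h0
  refine ⟨j, by omega, not_not.1 (Nat.find_min hex (m := j) (by omega)), ?_⟩
  have := Nat.find_spec hex
  rwa [hj] at this

end NormalSeries

/-- The first nontrivial intersection of `K` with a term `H` of the series embeds in a factor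
isomorphic to a Sylow subgroup `P`. Its index in `K` divides `|G : H|`, which divides `|G : P|` and
is prime to `p`. -/
theorem HasSylowTower.hasNormalSylowSubgroups {G : Type*} [Group G] [Finite G]
    (h : HasSylowTower G) : HasNormalSylowSubgroups G := by
  obtain ⟨S, hS⟩ := h
  intro K hK
  have : Nontrivial K := (nontrivial_iff_ne_bot _).2 hK
  obtain ⟨i, hi, h0, h1⟩ := S.exists_lt_length_map_ne_bot K (MonoidHom.id K)
    Function.surjective_id
  rw [map_id] at h0 h1
  obtain ⟨p, hp, P, ⟨e⟩⟩ := hS i hi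
  have : Fact p.Prime := ⟨hp⟩
  refine ⟨p, hp, (S.term (i + 1)).subgroupOf K, inferInstance, h1, ?_, ?_⟩
  · have hinj : Function.Injective (S.toFactor K i) := by
      rw [← MonoidHom.ker_eq_bot_iff, eq_bot_iff]
      intro x hx
      have hx' : (x : K) ∈ (S.term i).subgroupOf K := S.mem_ker_toFactor.1 hx
      rw [h0, mem_bot] at hx'
      exact mem_bot.2 (Subtype.ext hx')
    exact (P.isPGroup'.of_equiv e.symm).of_injective _ hinj
  · rw [hp.coprime_iff_not_dvd]
    intro hdvd
    refine P.not_dvd_index ((hdvd.trans ((S.term (i + 1)).relIndex_dvd_index_of_normal K)).trans ?_)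
    have hP : Nat.card P ∣ Nat.card (S.term (i + 1)) := by
      rw [← Nat.card_congr e.toEquiv]
      exact card_quotient_dvd_card _
    refine Nat.dvd_of_mul_dvd_mul_left (Nat.card_pos (α := P)) ?_
    rw [card_mul_index, ← (S.term (i + 1)).card_mul_index]
    exact mul_dvd_mul_right hP _

/-- Every nontrivial quotient has a nontrivial cyclic normal subgroup. -/
def HasCyclicNormalSubgroups (G : Type u) [Group G] : Prop :=
  ∀ (L : Type u) [Group L] [Nontrivial L] (g : G →* L), Function.Surjective g →
    ∃ N : Subgroup L, N.Normal ∧ N ≠ ⊥ ∧ IsCyclic N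

theorem MonoidHom.isCyclic_range_of_ker_le {J F L : Type*} [Group J] [Group F] [Group L]
    [IsCyclic F] {h : J →* F} {g : J →* L} (hle : h.ker ≤ g.ker) : IsCyclic g.range := by
  have : IsCyclic (J ⧸ h.ker) :=
    isCyclic_of_surjective (QuotientGroup.quotientKerEquivRange h).symm
      (QuotientGroup.quotientKerEquivRange h).symm.surjective
  have hr : (QuotientGroup.lift h.ker g hle).range = g.range := by
    ext x
    exact (QuotientGroup.mk'_surjective h.ker).exists
  rw [← hr]
  exact isCyclic_of_surjective _ (MonoidHom.rangeRestrict_surjective _)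

/-- The first nontrivial image in `L` of a term intersected with `K` is cyclic, because the map onto
it kills the kernel of the map to a cyclic factor. -/
theorem IsSupersoluble.hasCyclicNormalSubgroups {G : Type u} [Group G] (h : IsSupersoluble G)
    (K : Subgroup G) : HasCyclicNormalSubgroups K := by
  obtain ⟨S, hS⟩ := h
  intro L _ _ g hg
  obtain ⟨i, hi, h0, h1⟩ := S.exists_lt_length_map_ne_bot K g hg
  refine ⟨_, Normal.map inferInstance g hg, h1, ?_⟩
  have := hS i hi
  have hle : (S.toFactor K i).ker ≤ (g.comp (Subgroup.subtype _)).ker := by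
    intro x hx
    rw [Subgroup.map_eq_bot_iff] at h0
    exact h0 (S.mem_ker_toFactor.1 hx : (x : K) ∈ (S.term i).subgroupOf K)
  have := MonoidHom.isCyclic_range_of_ker_le hle
  rwa [MonoidHom.range_comp, range_subtype] at this

theorem Subgroup.exists_normal_prime_card_of_isCyclic {G : Type*} [Group G] [Finite G]
    {N : Subgroup G} (hN : N.Normal) (hbot : N ≠ ⊥) (hc : IsCyclic N) :
    ∃ q : ℕ, q.Prime ∧ ∃ A : Subgroup G, A.Normal ∧ Nat.card A = q := by
  obtain ⟨x, hx⟩ := Subgroup.isCyclic_iff_exists_zpowers_eq_top N |>.1 hc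
  have hmem : ∀ y, y ∈ N ↔ ∃ k : ℤ, x ^ k = y := fun y => by rw [← hx, mem_zpowers_iff]
  have hx1 : orderOf x ≠ 1 := fun h => hbot (by
    rw [← hx, orderOf_eq_one_iff.1 h, zpowers_one_eq_bot])
  obtain ⟨q, hq, m, hm⟩ := Nat.exists_prime_and_dvd hx1
  -- Here `orderOf x = q * m`, so `x ^ m` has order `q`; conjugation sends `x` to a power of itself
  -- and so preserves this subgroup.
  refine ⟨q, hq, zpowers (x ^ m), ⟨?_⟩, ?_⟩
  · rintro _ ⟨l, rfl⟩ g
    obtain ⟨k, hk⟩ := (hmem _).1 (hN.conj_mem x ((hmem x).2 ⟨1, zpow_one x⟩) g)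
    refine mem_zpowers_iff.2 ⟨k * l, ?_⟩
    rw [conj_zpow.symm, conj_pow.symm, ← hk]
    group
  · rw [Nat.card_zpowers]
    have hpos : 0 < q * m := hm ▸ orderOf_pos x
    have hm0 : m ≠ 0 := fun h => by simp [h] at hpos
    rw [orderOf_pow_of_dvd hm0 (hm ▸ dvd_mul_left m q), hm]
    exact Nat.mul_div_cancel q (Nat.pos_of_ne_zero hm0)

theorem HasCyclicNormalSubgroups.of_surjective {G H : Type u} [Group G] [Group H]
    (hG : HasCyclicNormalSubgroups G) (g : G →* H) (hg : Function.Surjective g) :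
    HasCyclicNormalSubgroups H :=
  fun L _ _ k hk => hG L (k.comp g) (hk.comp hg)

theorem Sylow.normal_of_prime_lt {G : Type*} [Group G] [Finite G] {p q : ℕ} [Fact p.Prime]
    (hqp : q < p) (hq : q.Prime) (P : Sylow p G) (hidx : P.index ∣ q) : P.Normal := by
  have hdvd : Nat.card (Sylow p G) ∣ q := P.card_dvd_index.trans hidx
  have hmod := card_sylow_modEq_one p G
  have h1 : Nat.card (Sylow p G) = 1 := by
    rcases (Nat.dvd_prime hq).1 hdvd with h | h
    · exact h
    · rw [h] at hmod
      exact absurd (hmod.eq_of_lt_of_lt hqp (hq.one_lt.trans hqp)) hq.ne_one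
  have : Subsingleton (Sylow p G) := (Nat.card_eq_one_iff_unique.1 h1).1
  exact P.normal_of_subsingleton

/-- For a normal subgroup `A` of prime order `q`, induction makes `AP` normal. If `q = p`, then `A ≤
P`. If `q < p`, Sylow counting makes `P` normal, hence characteristic, in `AP`, and so normal in
`G`. -/
theorem HasCyclicNormalSubgroups.sylow_normal {G : Type u} [Group G] [Finite G]
    (hG : HasCyclicNormalSubgroups G) {p : ℕ} [hp : Fact p.Prime]
    (hmax : ∀ q : ℕ, q.Prime → q ∣ Nat.card G → q ≤ p) (P : Sylow p G) : P.Normal := by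
  induction hn : Nat.card G using Nat.strong_induction_on generalizing G with
  | _ n ih =>
  rcases subsingleton_or_nontrivial G with h | h
  · rw [Subsingleton.elim (P : Subgroup G) ⊥]
    infer_instance
  obtain ⟨N, hN, hbot, hc⟩ := hG G (MonoidHom.id G) Function.surjective_id
  obtain ⟨q, hq, A, hA, hAq⟩ := exists_normal_prime_card_of_isCyclic hN hbot hc
  have hlt : Nat.card (G ⧸ A) < n := by
    rw [← hn, card_eq_card_quotient_mul_card_subgroup A, hAq]
    exact lt_mul_of_one_lt_right Nat.card_pos hq.one_lt
  have hmk := QuotientGroup.mk'_surjective A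
  have hQ : ((P : Subgroup G).map (QuotientGroup.mk' A)).Normal := by
    have := ih _ hlt (hG.of_surjective _ hmk)
      (fun r hr h => hmax r hr (h.trans (card_quotient_dvd_card A))) (P.mapSurjective hmk) rfl
    rwa [Sylow.coe_mapSurjective] at this
  have hK : (A ⊔ P : Subgroup G).Normal := by
    rw [← QuotientGroup.comap_map_mk']
    exact hQ.comap _
  rcases (hmax q hq (hAq ▸ card_subgroup_dvd_card A)).eq_or_lt with rfl | hqp
  · have hAP : A ≤ P := (IsPGroup.of_card (n := 1) (by rw [hAq, pow_one])).le_sylow_of_normal P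
    rwa [sup_eq_right.2 hAP] at hK
  · set K : Subgroup G := A ⊔ P
    have hPK : (P : Subgroup G) ≤ K := le_sup_right
    have hidx : (P.subtype hPK).index ∣ q := by
      refine Nat.dvd_of_mul_dvd_mul_right (Nat.card_pos (α := P)) ?_
      have h1 : (P : Subgroup G).relIndex K * Nat.card P = Nat.card K := by
        rw [← relIndex_mul_natCard_inf (P : Subgroup G) K, inf_eq_left.2 hPK]
      have h2 : A.relIndex K * Nat.card A = Nat.card K := by
        rw [← relIndex_mul_natCard_inf A K, inf_eq_left.2 le_sup_left]
      change (P : Subgroup G).relIndex K * Nat.card P ∣ _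
      rw [h1, ← h2, hAq, relIndex_sup_left, mul_comm]
      exact mul_dvd_mul_left q (A.relIndex_dvd_card P)
    have hn := (P.subtype hPK).normal_of_prime_lt hqp hq hidx
    have hchar := (P.subtype hPK).characteristic_of_normal hn
    have := ConjAct.normal_of_characteristic_of_normal (H := K)
      (K := ((P.subtype hPK : Sylow p K) : Subgroup K))
    rwa [Sylow.coe_subtype, map_subgroupOf_eq_of_le hPK] at this

theorem IsSupersoluble.hasNormalSylowSubgroups {G : Type*} [Group G] [Finite G]
    (h : IsSupersoluble G) : HasNormalSylowSubgroups G := by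
  intro K hK
  have : Nontrivial K := (nontrivial_iff_ne_bot _).2 hK
  have hne : (Nat.card K).primeFactors.Nonempty :=
    Nat.nonempty_primeFactors.2 Finite.one_lt_card
  -- The Sylow subgroup for the largest prime divisor is the normal one.
  set p := (Nat.card K).primeFactors.max' hne
  have hpmem : p ∈ (Nat.card K).primeFactors := Finset.max'_mem _ _
  have hp : Fact p.Prime := ⟨Nat.prime_of_mem_primeFactors hpmem⟩
  let P : Sylow p K := default
  refine ⟨p, hp.out, P, (h.hasCyclicNormalSubgroups K).sylow_normal (fun q hq hdvd => ?_) P,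
    P.ne_bot_of_dvd_card (Nat.dvd_of_mem_primeFactors hpmem), P.isPGroup',
    (hp.out.coprime_iff_not_dvd).2 P.not_dvd_index⟩
  exact Finset.le_max' _ _ (Nat.mem_primeFactors.2 ⟨hq, hdvd, Nat.card_pos.ne'⟩)

theorem mainTheorem6 (G : Type*) [Group G] [Finite G] :
    (HasSylowTower G →
      ∀ C : Subgroup G, IsCarterSubgroup C → ∀ X : Subgroup G, X ≤ C →
        carterCount X ∣ C.index) ∧
    (IsSupersoluble G →
      ∀ C : Subgroup G, IsCarterSubgroup C → ∀ X : Subgroup G, X ≤ C →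
        carterCount X ∣ C.index) :=
  ⟨fun h _ hC _ hX => h.hasNormalSylowSubgroups.carterCount_dvd_index hC hX,
    fun h _ hC _ hX => h.hasNormalSylowSubgroups.carterCount_dvd_index hC hX⟩
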